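/- Let $\sigma(j)=\sum_{d\mid j}d$ be the sum-of-divisors function and, for $n\ge 0$, let $T(n)$ be the number of ordered triples $(a,b,c)$ of pairwise commuting elements of the symmetric group $S_n$ (where $S_0$ is the trivial group). Then, as formal power series in $u$ with rational coefficients, $$\prod_{j=1}^{\infty}\left(1-u^j\right)^{-\sigma(j)}=\sum_{n=0}^{\infty}\frac{T(n)}{n!}\,u^n ,$$ where the infinite product converges in the formal sense: each coefficient of the finite partial products is eventually constant. -/

import Mathlib

/-- The number of triples of pairwise commuting elements of the symmetric group on `n` points. -/
noncomputable def commutingTriples (n : ℕ) : ℕ :=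
  Nat.card {p : Equiv.Perm (Fin n) × Equiv.Perm (Fin n) × Equiv.Perm (Fin n) //
    Commute p.1 p.2.1 ∧ Commute p.1 p.2.2 ∧ Commute p.2.1 p.2.2}

/-- The topology of formal convergence on `ℚ⟦u⟧`: coefficientwise convergence for the discrete
topology on `ℚ`, that is, every coefficient is eventually constant. -/
@[reducible]
noncomputable def formalTopology : TopologicalSpace (PowerSeries ℚ) :=
  @PowerSeries.WithPiTopology.instTopologicalSpace ℚ ⊥

/-! A commuting triple is a permutation `a` together with a commuting pair fixed under conjugation
by `a`, so by Burnside's lemma T(n)/n! is the number of conjugation orbits of commuting pairs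
(`commutingTriples_eq_card_orbits_mul_factorial`). A commuting pair is an action of ℤ² on n points,
and its orbit is an isomorphism class of ℤ²-sets. Since ℤ² is abelian, a finite ℤ²-set is determined
up to isomorphism by how many points have each stabilizer `H`; that number can be any multiple of
the index of `H`, subject to total n (`CommutingPair.card_orbits`). The generating function of the
classes is therefore the product of (1 - u^[ℤ²:H])⁻¹ over the subgroups of finite index, and Hermite
normal form gives σ(j) subgroups of index j (`card_subgroupsOfIndex`). -/

/-! ### Coefficients of products of geometric series. -/

open PowerSeries in
theorem coeff_inv_one_sub_X_pow {k : ℕ} (hk : 0 < k) (m : ℕ) :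
    coeff m ((1 - (X : ℚ⟦X⟧) ^ k)⁻¹) = if k ∣ m then 1 else 0 := by
  have hinv : (1 - (X : ℚ⟦X⟧) ^ k)⁻¹ = mk fun m => if k ∣ m then (1 : ℚ) else 0 := by
    rw [PowerSeries.inv_eq_iff_mul_eq_one (by simp [hk.ne'])]
    ext m
    rw [mul_sub, mul_one, map_sub, coeff_mk, coeff_mul_X_pow', coeff_one]
    by_cases hm : k ≤ m
    · have hm0 : m ≠ 0 := by omega
      simp [hm, hm0, Nat.dvd_sub_iff_left hm (dvd_refl k)]
    · rw [if_neg hm]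
      rcases Nat.eq_zero_or_pos m with rfl | h0
      · simp
      · rw [if_neg fun h => hm (Nat.le_of_dvd h0 h), if_neg h0.ne', sub_zero]
  rw [hinv, coeff_mk]

-- Here `l i` is the total degree contributed by the factor `i`, not a multiplicity; hence the
-- divisibility condition.
open PowerSeries in
theorem coeff_prod_inv_one_sub_X_pow {ι : Type*} [DecidableEq ι] (w : ι → ℕ) (s : Finset ι)
    (hw : ∀ i ∈ s, 0 < w i) (n : ℕ) :
    coeff n (∏ i ∈ s, (1 - (X : ℚ⟦X⟧) ^ w i)⁻¹) =
      (((s.finsuppAntidiag n).filter fun l => ∀ i ∈ s, w i ∣ l i).card : ℚ) := by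
  rw [coeff_prod, Finset.card_filter, Nat.cast_sum]
  refine Finset.sum_congr rfl fun l _ => ?_
  rw [Finset.prod_congr rfl fun i hi => coeff_inv_one_sub_X_pow (hw i hi) (l i),
    Finset.prod_ite_zero]
  simp

/-! ### Finite-index subgroups of ℤ² and their Hermite bases. -/

/-- The image of `inl` is the kernel of `snd`, so the index factors through the intermediate
subgroup `H ⊔ ker snd`. -/
theorem AddSubgroup.index_comap_inl_mul_index_map_snd {A B : Type*} [AddCommGroup A]
    [AddCommGroup B] (H : AddSubgroup (A × B)) :
    (H.comap (AddMonoidHom.inl A B)).index * (H.map (AddMonoidHom.snd A B)).index = H.index := by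
  have hker : (AddMonoidHom.inl A B).range = (AddMonoidHom.snd A B).ker := by
    ext ⟨a, b⟩
    simp only [AddMonoidHom.mem_range, AddMonoidHom.mem_ker, AddMonoidHom.inl_apply, Prod.mk.injEq,
      exists_eq_left, AddMonoidHom.coe_snd, eq_comm (a := (0 : B))]
  rw [AddSubgroup.index_comap, hker,
    ← AddSubgroup.index_comap_of_surjective _ (f := AddMonoidHom.snd A B) Prod.snd_surjective,
    AddSubgroup.comap_map_eq, sup_comm, ← AddSubgroup.relIndex_sup_right,
    AddSubgroup.relIndex_mul_index le_sup_right]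

theorem Int.eq_zmultiples_index (H : AddSubgroup ℤ) : H = AddSubgroup.zmultiples (H.index : ℤ) := by
  obtain ⟨a, rfl⟩ := Int.subgroup_cyclic H
  rw [← AddSubgroup.zmultiples_eq_closure, Int.index_zmultiples]
  exact (Int.zmultiples_natAbs a).symm

/-- The subgroup of `ℤ × ℤ` with Hermite basis `(d, 0)`, `(r, e)`. -/
def hermiteLattice (d r e : ℕ) : AddSubgroup (ℤ × ℤ) :=
  AddSubgroup.closure {((d : ℤ), (0 : ℤ)), ((r : ℤ), (e : ℤ))}

theorem mem_hermiteLattice {d r e : ℕ} {v : ℤ × ℤ} :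
    v ∈ hermiteLattice d r e ↔ ∃ m k : ℤ, m * d + k * r = v.1 ∧ k * e = v.2 := by
  rw [hermiteLattice, AddSubgroup.mem_closure_pair]
  simp [Prod.ext_iff]

theorem comap_inl_hermiteLattice {d r e : ℕ} (he : e ≠ 0) :
    (hermiteLattice d r e).comap (AddMonoidHom.inl ℤ ℤ) = AddSubgroup.zmultiples (d : ℤ) := by
  ext x
  rw [AddSubgroup.mem_comap, mem_hermiteLattice, AddSubgroup.mem_zmultiples_iff]
  simp [he]

theorem map_snd_hermiteLattice (d r e : ℕ) :
    (hermiteLattice d r e).map (AddMonoidHom.snd ℤ ℤ) = AddSubgroup.zmultiples (e : ℤ) := by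
  rw [hermiteLattice, AddMonoidHom.map_closure, Set.image_pair]
  ext x
  simp [AddSubgroup.zmultiples_eq_closure]

theorem index_hermiteLattice {d r e : ℕ} (he : e ≠ 0) : (hermiteLattice d r e).index = d * e := by
  rw [← AddSubgroup.index_comap_inl_mul_index_map_snd, comap_inl_hermiteLattice he,
    map_snd_hermiteLattice, Int.index_zmultiples, Int.index_zmultiples, Int.natAbs_natCast,
    Int.natAbs_natCast]

/-- `d` generates the intersection with the first axis and `e` the projection to the second. -/
theorem exists_eq_hermiteLattice (H : AddSubgroup (ℤ × ℤ)) (hH : H.index ≠ 0) :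
    ∃ d r e : ℕ, r < d ∧ d * e = H.index ∧ H = hermiteLattice d r e := by
  obtain ⟨d, hd⟩ : ∃ d, d = (H.comap (AddMonoidHom.inl ℤ ℤ)).index := ⟨_, rfl⟩
  obtain ⟨e, he⟩ : ∃ e, e = (H.map (AddMonoidHom.snd ℤ ℤ)).index := ⟨_, rfl⟩
  have hde := H.index_comap_inl_mul_index_map_snd
  have h1 := Int.eq_zmultiples_index (H.comap (AddMonoidHom.inl ℤ ℤ))
  have h2 := Int.eq_zmultiples_index (H.map (AddMonoidHom.snd ℤ ℤ))
  rw [← hd] at h1 hde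
  rw [← he] at h2 hde
  have hd0 : d ≠ 0 := by rintro rfl; exact hH (by rw [← hde, zero_mul])
  have hmem1 : ∀ x : ℤ, (x, (0 : ℤ)) ∈ H ↔ ∃ k : ℤ, k * d = x := fun x => by
    have : x ∈ H.comap (AddMonoidHom.inl ℤ ℤ) ↔ x ∈ AddSubgroup.zmultiples (d : ℤ) := by rw [← h1]
    simpa [AddSubgroup.mem_zmultiples_iff] using this
  have hmem2 : ∀ y : ℤ, (∃ x : ℤ, (x, y) ∈ H) ↔ ∃ k : ℤ, k * e = y := fun y => by
    have : y ∈ H.map (AddMonoidHom.snd ℤ ℤ) ↔ y ∈ AddSubgroup.zmultiples (e : ℤ) := by rw [← h2]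
    simpa [AddSubgroup.mem_zmultiples_iff] using this
  -- A vector of `H` above `e`; subtracting a multiple of `(d, 0)` reduces its first coordinate to
  -- `r`.
  obtain ⟨t, ht⟩ := (hmem2 e).2 ⟨1, one_mul _⟩
  have hr0 : 0 ≤ t % d := Int.emod_nonneg _ (by exact_mod_cast hd0)
  have hrd : t % d < d := Int.emod_lt_of_pos _ (by positivity)
  obtain ⟨r, hr⟩ := Int.eq_ofNat_of_zero_le hr0
  have hre : ((r : ℤ), (e : ℤ)) ∈ H := by
    have := H.sub_mem ht ((hmem1 (t / d * d)).2 ⟨_, rfl⟩)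
    rwa [Prod.mk_sub_mk, sub_zero, mul_comm, ← Int.emod_def, hr] at this
  refine ⟨d, r, e, by omega, hde, le_antisymm ?_ ?_⟩
  · rintro ⟨x, y⟩ hxy
    obtain ⟨k, rfl⟩ := (hmem2 y).1 ⟨x, hxy⟩
    have := H.sub_mem hxy (H.zsmul_mem hre k)
    rw [Prod.smul_mk, Prod.mk_sub_mk, smul_eq_mul, smul_eq_mul, sub_self, hmem1] at this
    obtain ⟨m, hm⟩ := this
    exact mem_hermiteLattice.2 ⟨m, k, by simp [hm], rfl⟩
  · rw [hermiteLattice, AddSubgroup.closure_le]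
    rintro v (rfl | rfl)
    · exact (hmem1 d).2 ⟨1, one_mul _⟩
    · exact hre

/-- `d` and `e` are recovered as indices of the intersection and the projection, `r` as a residue
modulo `d`. -/
theorem hermiteLattice_injective {d r e d' r' e' : ℕ} (he : e ≠ 0) (he' : e' ≠ 0) (hr : r < d)
    (hr' : r' < d') (h : hermiteLattice d r e = hermiteLattice d' r' e') :
    d = d' ∧ r = r' ∧ e = e' := by
  have h1 := comap_inl_hermiteLattice (d := d) (r := r) he
  have h2 := map_snd_hermiteLattice d r e
  rw [h, comap_inl_hermiteLattice he'] at h1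
  rw [h, map_snd_hermiteLattice] at h2
  have hd := congrArg AddSubgroup.index h1
  have hee := congrArg AddSubgroup.index h2
  simp only [Int.index_zmultiples, Int.natAbs_natCast] at hd hee
  subst hd hee
  refine ⟨rfl, ?_, rfl⟩
  have hmem : ((r : ℤ), (e' : ℤ)) ∈ hermiteLattice d' r' e' := by
    rw [← h, mem_hermiteLattice]
    exact ⟨0, 1, by simp, by simp⟩
  obtain ⟨m, k, hm, hk⟩ := mem_hermiteLattice.1 hmem
  have hk1 : k = 1 := by
    have : (e' : ℤ) ≠ 0 := by exact_mod_cast he'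
    exact mul_right_cancel₀ this (by simpa using hk)
  subst hk1
  have : ((r : ℤ)) % d' = (r' : ℤ) % d' := by
    rw [show (r : ℤ) = m * d' + 1 * r' from hm.symm]
    simp
  rw [Int.emod_eq_of_lt (by positivity) (by exact_mod_cast hr),
    Int.emod_eq_of_lt (by positivity) (by exact_mod_cast hr')] at this
  exact_mod_cast this

/-- The free abelian group of rank two, written multiplicatively. -/
abbrev Z2 := Multiplicative (ℤ × ℤ)

open Classical in
/-- The subgroups of index `j` in the free abelian group of rank two. -/
noncomputable def subgroupsOfIndex (j : ℕ) : Finset (Subgroup Z2) :=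
  (j.divisors.sigma fun d => Finset.range d).image fun p =>
    AddSubgroup.toSubgroup (hermiteLattice p.1 p.2 (j / p.1))

theorem mem_subgroupsOfIndex {j : ℕ} (hj : j ≠ 0) {H : Subgroup Z2} :
    H ∈ subgroupsOfIndex j ↔ H.index = j := by
  simp only [subgroupsOfIndex, Finset.mem_image, Finset.mem_sigma, Nat.mem_divisors,
    Finset.mem_range, Sigma.exists]
  constructor
  · rintro ⟨d, r, ⟨⟨hd, -⟩, -⟩, rfl⟩
    rw [AddSubgroup.index_toSubgroup, index_hermiteLattice, Nat.mul_div_cancel' hd]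
    exact (Nat.div_pos (Nat.le_of_dvd (Nat.pos_of_ne_zero hj) hd)
      (Nat.pos_of_dvd_of_pos hd (Nat.pos_of_ne_zero hj))).ne'
  · rintro rfl
    obtain ⟨K, rfl⟩ := AddSubgroup.toSubgroup.surjective H
    rw [AddSubgroup.index_toSubgroup] at hj ⊢
    obtain ⟨d, r, e, hr, hde, hK⟩ := exists_eq_hermiteLattice K hj
    refine ⟨d, r, ⟨⟨⟨e, hde.symm⟩, hj⟩, hr⟩, ?_⟩
    rw [← hde, Nat.mul_div_cancel_left _ (by omega), ← hK]

theorem card_subgroupsOfIndex {j : ℕ} (hj : j ≠ 0) :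
    (subgroupsOfIndex j).card = ArithmeticFunction.sigma 1 j := by
  classical
  rw [subgroupsOfIndex, Finset.card_image_of_injOn, Finset.card_sigma,
    ArithmeticFunction.sigma_one_apply]
  · simp
  · rintro ⟨d, r⟩ h ⟨d', r'⟩ h' heq
    simp only [Finset.coe_sigma, Set.mem_sigma_iff, Finset.mem_coe, Nat.mem_divisors,
      Finset.mem_range] at h h'
    have hpos : ∀ {d}, d ∣ j → j / d ≠ 0 := fun hd =>
      (Nat.div_pos (Nat.le_of_dvd (Nat.pos_of_ne_zero hj) hd)
        (Nat.pos_of_dvd_of_pos hd (Nat.pos_of_ne_zero hj))).ne'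
    obtain ⟨rfl, rfl, -⟩ := hermiteLattice_injective (hpos h.1.1) (hpos h'.1.1) h.2 h'.2
      (AddSubgroup.toSubgroup.injective heq)
    rfl

/-! ### Actions of abelian groups, classified by stabilizer counts. -/

section Actions

open MulAction

variable {G : Type*} [CommGroup G]

theorem stabilizer_smul_of_comm {X : Type*} [MulAction G X] (g : G) (x : X) :
    stabilizer G (g • x) = stabilizer G x := by
  ext a
  rw [mem_stabilizer_iff, mem_stabilizer_iff, smul_smul, mul_comm, ← smul_smul, smul_left_cancel_iff]

theorem exists_smul_out_eq {X : Type*} [MulAction G X] (x : X) :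
    ∃ g : G, g • (Quotient.mk (orbitRel G X) x).out = x := by
  have h : (orbitRel G X) x (Quotient.mk (orbitRel G X) x).out :=
    (orbitRel G X).symm (Quotient.mk_out (s := orbitRel G X) x)
  exact h

theorem stabilizer_out_mk {X : Type*} [MulAction G X] (x : X) :
    stabilizer G (Quotient.mk (orbitRel G X) x).out = stabilizer G x := by
  obtain ⟨g, hg⟩ := exists_smul_out_eq (G := G) x
  conv_rhs => rw [← hg]
  rw [stabilizer_smul_of_comm]

/-- The number of points whose stabilizer is `H`. -/
noncomputable def stabilizerCount (X : Type*) [MulAction G X] (H : Subgroup G) : ℕ :=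
  Nat.card {x : X // stabilizer G x = H}

/-- Stabilizers are constant on orbits because `G` is commutative, so these points form whole
orbits, each of size `H.index`. -/
theorem stabilizerCount_eq_mul_index (X : Type*) [Finite X] [MulAction G X] (H : Subgroup G) :
    stabilizerCount X H =
      Nat.card {ω : Quotient (orbitRel G X) // stabilizer G ω.out = H} * H.index := by
  classical
  have := Fintype.ofFinite X
  have := Fintype.ofFinite (Quotient (orbitRel G X))
  rw [stabilizerCount, Nat.card_eq_fintype_card, Nat.card_eq_fintype_card, Fintype.card_subtype,
    Fintype.card_subtype, Finset.card_eq_sum_card_fiberwise (f := Quotient.mk (orbitRel G X))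
      (t := Finset.univ.filter fun ω => stabilizer G ω.out = H)]
  · refine Finset.sum_const_nat fun ω hω => ?_
    rw [Finset.mem_filter] at hω
    rw [← hω.2, index_stabilizer, Set.ncard_eq_toFinset_card']
    congr 1
    ext x
    simp only [Finset.mem_filter, Finset.mem_univ, true_and, Set.mem_toFinset]
    constructor
    · rintro ⟨-, rfl⟩
      exact exists_smul_out_eq x
    · rintro h
      have hx : Quotient.mk (orbitRel G X) x = ω := by
        rw [← ω.out_eq]
        exact Quotient.sound h
      refine ⟨?_, hx⟩
      rw [← hx, stabilizer_out_mk]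
  · intro x hx
    simpa [stabilizer_out_mk] using hx

theorem index_stabilizer_ne_zero {X : Type*} [Finite X] [MulAction G X] (x : X) :
    (stabilizer G x).index ≠ 0 := by
  rw [index_stabilizer]
  exact ((Set.ncard_pos (Set.toFinite _)).2 ⟨x, mem_orbit_self x⟩).ne'

/-- Equal counts allow orbits to be matched with equal stabilizers; the match extends equivariantly
from orbit representatives. -/
theorem exists_equivariant_equiv {X Y : Type*} [Finite X] [Finite Y] [MulAction G X] [MulAction G Y]
    (h : ∀ H : Subgroup G, stabilizerCount X H = stabilizerCount Y H)
    (hcard : Nat.card X = Nat.card Y) :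
    ∃ e : X ≃ Y, ∀ (g : G) (x : X), e (g • x) = g • e x := by
  classical
  have hfib : ∀ H : Subgroup G, Nonempty ({ω : Quotient (orbitRel G X) // stabilizer G ω.out = H} ≃
      {ω : Quotient (orbitRel G Y) // stabilizer G ω.out = H}) := fun H => by
    have hX := stabilizerCount_eq_mul_index X H
    have hY := stabilizerCount_eq_mul_index Y H
    refine ⟨(Finite.card_eq.1 ?_).some⟩
    -- Index 0 means infinite index: it cannot be cancelled, but then no point has stabilizer `H`.
    rcases eq_or_ne H.index 0 with h0 | h0
    · have hXe : IsEmpty {ω : Quotient (orbitRel G X) // stabilizer G ω.out = H} :=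
        ⟨fun ω => index_stabilizer_ne_zero ω.1.out (by rw [ω.2, h0])⟩
      have hYe : IsEmpty {ω : Quotient (orbitRel G Y) // stabilizer G ω.out = H} :=
        ⟨fun ω => index_stabilizer_ne_zero ω.1.out (by rw [ω.2, h0])⟩
      rw [Nat.card_of_isEmpty, Nat.card_of_isEmpty]
    · exact Nat.eq_of_mul_eq_mul_right (Nat.pos_of_ne_zero h0) (by rw [← hX, ← hY, h])
  let E : Quotient (orbitRel G X) ≃ Quotient (orbitRel G Y) :=
    (Equiv.sigmaFiberEquiv fun ω : Quotient (orbitRel G X) => stabilizer G ω.out).symm.trans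
      ((Equiv.sigmaCongrRight fun H => (hfib H).some).trans
        (Equiv.sigmaFiberEquiv fun ω : Quotient (orbitRel G Y) => stabilizer G ω.out))
  have hE : ∀ ω, stabilizer G (E ω).out = stabilizer G ω.out := fun ω =>
    ((hfib (stabilizer G ω.out)).some ⟨ω, rfl⟩).2
  choose γ hγ using fun x : X => exists_smul_out_eq (G := G) x
  let f : X → Y := fun x => γ x • (E (Quotient.mk _ x)).out
  -- Equality of stabilizers makes `f` independent of the choice of `γ`, and injective on each
  -- orbit.
  have key : ∀ (a b : G) (ω : Quotient (orbitRel G X)),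
      a • ω.out = b • ω.out ↔ a • (E ω).out = b • (E ω).out := fun a b ω => by
    rw [← inv_smul_eq_iff, smul_smul, ← mem_stabilizer_iff, ← hE, mem_stabilizer_iff, ← smul_smul,
      inv_smul_eq_iff]
  have hinj : Function.Injective f := fun x y hxy => by
    have hq : Quotient.mk (orbitRel G X) x = Quotient.mk (orbitRel G X) y := by
      refine E.injective ?_
      rw [← (E (Quotient.mk _ x)).out_eq, ← (E (Quotient.mk _ y)).out_eq]
      refine Quotient.sound ?_
      refine ⟨(γ x)⁻¹ * γ y, ?_⟩
      change ((γ x)⁻¹ * γ y) • _ = _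
      rw [← smul_smul, inv_smul_eq_iff]
      exact hxy.symm
    rw [← hγ x, ← hγ y, ← hq, key]
    exact hxy.trans (by rw [hq])
  refine ⟨Equiv.ofBijective f ((Nat.bijective_iff_injective_and_card f).2 ⟨hinj, hcard⟩),
    fun g x => ?_⟩
  have hq : Quotient.mk (orbitRel G X) (g • x) = Quotient.mk (orbitRel G X) x :=
    Quotient.sound ⟨g, rfl⟩
  change γ (g • x) • (E (Quotient.mk _ (g • x))).out = g • γ x • (E (Quotient.mk _ x)).out
  rw [hq, smul_smul, ← key, ← smul_smul, hγ, ← hq, hγ]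

end Actions

section Actions

open MulAction

variable {G : Type*} [CommGroup G]

theorem stabilizerCount_congr {X Y : Type*} [MulAction G X] [MulAction G Y] (e : X ≃ Y)
    (he : ∀ (g : G) (x : X), e (g • x) = g • e x) (H : Subgroup G) :
    stabilizerCount X H = stabilizerCount Y H := by
  refine Nat.card_congr (e.subtypeEquiv fun x => ?_)
  have : stabilizer G (e x) = stabilizer G x := by
    ext g
    rw [mem_stabilizer_iff, mem_stabilizer_iff, ← he, e.apply_eq_iff_eq]
  rw [this]

theorem sum_stabilizerCount {X : Type*} [Finite X] [MulAction G X] (s : Finset (Subgroup G))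
    (hs : ∀ x : X, stabilizer G x ∈ s) : ∑ H ∈ s, stabilizerCount X H = Nat.card X := by
  classical
  have := Fintype.ofFinite X
  rw [Nat.card_eq_fintype_card, ← Finset.card_univ,
    Finset.card_eq_sum_card_fiberwise (f := fun x : X => stabilizer G x) (t := s)
      fun x _ => hs x]
  refine Finset.sum_congr rfl fun H _ => ?_
  rw [stabilizerCount, Nat.card_eq_fintype_card, Fintype.card_subtype]

/-- The disjoint union of `m H` copies of `G ⧸ H`, for `H` in `s`. -/
abbrev CosetUnion (s : Finset (Subgroup G)) (m : Subgroup G → ℕ) : Type _ :=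
  Σ p : (Σ H : s, Fin (m H)), G ⧸ p.1.1

theorem stabilizer_cosetUnion {s : Finset (Subgroup G)} {m : Subgroup G → ℕ}
    (x : CosetUnion s m) : stabilizer G x = x.1.1.1 := by
  obtain ⟨⟨⟨H, hH⟩, i⟩, q⟩ := x
  obtain ⟨g, rfl⟩ := QuotientGroup.mk_surjective q
  ext a
  rw [mem_stabilizer_iff, Sigma.smul_mk, Sigma.mk.injEq]
  simp only [heq_eq_eq, true_and]
  rw [← mem_stabilizer_iff]
  have : (QuotientGroup.mk g : G ⧸ H) = g • (QuotientGroup.mk 1 : G ⧸ H) := by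
    rw [Quotient.smul_mk, smul_eq_mul, mul_one]
  rw [this, stabilizer_smul_of_comm, stabilizer_quotient]

theorem stabilizerCount_cosetUnion {s : Finset (Subgroup G)} {m : Subgroup G → ℕ}
    {H : Subgroup G} (hH : H ∈ s) : stabilizerCount (CosetUnion s m) H = m H * H.index := by
  have hbij : Function.Bijective (fun p : Fin (m H) × (G ⧸ H) =>
      (⟨⟨⟨⟨H, hH⟩, p.1⟩, p.2⟩, stabilizer_cosetUnion _⟩ :
        {x : CosetUnion s m // stabilizer G x = H})) := by
    constructor
    · rintro ⟨i, q⟩ ⟨i', q'⟩ h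
      simp only [Subtype.mk.injEq, Sigma.mk.injEq] at h
      obtain ⟨⟨-, h1⟩, h2⟩ := h
      cases h1
      cases h2
      rfl
    · rintro ⟨⟨⟨⟨K, hK⟩, i⟩, q⟩, h⟩
      rw [stabilizer_cosetUnion] at h
      subst h
      exact ⟨(i, q), rfl⟩
  rw [stabilizerCount, ← Nat.card_congr (Equiv.ofBijective _ hbij), Nat.card_prod, Nat.card_fin,
    Subgroup.index]

end Actions

/-! ### Commuting pairs of permutations as ℤ²-sets. -/

section CommutingPairs

open MulAction Equiv

/-- Pairs of commuting permutations. -/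
abbrev CommutingPair (X : Type*) := {p : Perm X × Perm X // Commute p.1 p.2}

variable {X : Type*}

instance CommutingPair.instMulAction : MulAction (Perm X) (CommutingPair X) where
  smul a p := ⟨(a * p.1.1 * a⁻¹, a * p.1.2 * a⁻¹), (Commute.conj_iff a).2 p.2⟩
  one_smul p := Subtype.ext (Prod.ext (by change 1 * _ * 1⁻¹ = _; simp)
    (by change 1 * _ * 1⁻¹ = _; simp))
  mul_smul a b p := Subtype.ext (Prod.ext
    (by change a * b * _ * (a * b)⁻¹ = a * (b * _ * b⁻¹) * a⁻¹; group)
    (by change a * b * _ * (a * b)⁻¹ = a * (b * _ * b⁻¹) * a⁻¹; group))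

theorem CommutingPair.smul_eq_iff {a : Perm X} {p q : CommutingPair X} :
    a • p = q ↔ a * p.1.1 = q.1.1 * a ∧ a * p.1.2 = q.1.2 * a := by
  rw [← mul_inv_eq_iff_eq_mul, ← mul_inv_eq_iff_eq_mul, Subtype.ext_iff, Prod.ext_iff]
  rfl

/-- The homomorphism determined by a commuting pair. -/
def CommutingPair.toHom (p : CommutingPair X) : Z2 →* Perm X where
  toFun g := p.1.1 ^ g.toAdd.1 * p.1.2 ^ g.toAdd.2
  map_one' := by simp
  map_mul' g h := by
    rw [toAdd_mul, Prod.fst_add, Prod.snd_add, zpow_add, zpow_add, mul_assoc, mul_assoc]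
    congr 1
    rw [← mul_assoc, ← mul_assoc, (p.2.zpow_zpow _ _).eq]

/-- The action determined by a commuting pair. -/
@[reducible]
def CommutingPair.action (p : CommutingPair X) : MulAction Z2 X := MulAction.compHom X p.toHom

/-- The number of points whose stabilizer is `H` in the action determined by `p`. -/
noncomputable def CommutingPair.count (p : CommutingPair X) (H : Subgroup Z2) : ℕ :=
  letI := p.action
  stabilizerCount X H

theorem CommutingPair.toHom_generators (p : CommutingPair X) :
    p.toHom (Multiplicative.ofAdd (1, 0)) = p.1.1 ∧
      p.toHom (Multiplicative.ofAdd (0, 1)) = p.1.2 := by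
  simp [toHom]

theorem CommutingPair.smul_eq_iff_equivariant {a : Perm X} {p q : CommutingPair X} :
    a • p = q ↔ ∀ (g : Z2) (x : X), a (p.toHom g x) = q.toHom g (a x) := by
  constructor
  · rintro rfl g x
    have : (a • p).toHom g = a * p.toHom g * a⁻¹ := by
      change (a * p.1.1 * a⁻¹) ^ g.toAdd.1 * (a * p.1.2 * a⁻¹) ^ g.toAdd.2 =
        a * (p.1.1 ^ g.toAdd.1 * p.1.2 ^ g.toAdd.2) * a⁻¹
      rw [conj_zpow, conj_zpow]
      group
    simp [this]
  · intro h
    rw [CommutingPair.smul_eq_iff, ← p.toHom_generators.1, ← p.toHom_generators.2,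
      ← q.toHom_generators.1, ← q.toHom_generators.2]
    exact ⟨Equiv.ext fun x => h _ x, Equiv.ext fun x => h _ x⟩

theorem CommutingPair.orbitRel_iff_count_eq [Finite X] {p q : CommutingPair X} :
    orbitRel (Perm X) (CommutingPair X) p q ↔ ∀ H, p.count H = q.count H := by
  constructor
  · rintro ⟨a, ha⟩ H
    rw [eq_comm]
    exact @stabilizerCount_congr Z2 _ X X q.action p.action a
      (CommutingPair.smul_eq_iff_equivariant.1 ha) H
  · intro h
    obtain ⟨e, he⟩ := @exists_equivariant_equiv Z2 _ X X _ _ q.action p.action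
      (fun H => (h H).symm) rfl
    exact ⟨e, CommutingPair.smul_eq_iff_equivariant.2 he⟩

theorem exists_commutingPair_count_eq {Y : Type*} [MulAction Z2 Y] (e : Y ≃ X) :
    ∃ p : CommutingPair X, ∀ H, p.count H = stabilizerCount Y H := by
  let ψ : Z2 →* Perm X := e.permCongrHom.toMonoidHom.comp (MulAction.toPermHom Z2 Y)
  let p : CommutingPair X := ⟨(ψ (Multiplicative.ofAdd (1, 0)), ψ (Multiplicative.ofAdd (0, 1))),
    (Commute.all _ _).map ψ⟩
  have hp : ∀ g, p.toHom g = ψ g := fun g => by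
    change ψ (Multiplicative.ofAdd (1, 0)) ^ g.toAdd.1 * ψ (Multiplicative.ofAdd (0, 1)) ^ g.toAdd.2 =
      ψ g
    rw [← map_zpow ψ, ← map_zpow ψ, ← map_mul ψ, ← ofAdd_zsmul, ← ofAdd_zsmul, ← ofAdd_add]
    simp
  refine ⟨p, fun H => ?_⟩
  refine (@stabilizerCount_congr Z2 _ Y X _ p.action e (fun g x => ?_) H).symm
  change _ = p.toHom g (e x)
  rw [hp]
  simp [ψ]

/-- The bijection sends an orbit to its stabilizer counts. Only indices up to `n` occur, since an
orbit has at most `n` points. -/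
theorem CommutingPair.card_orbits {n : ℕ} [DecidableEq (Subgroup Z2)] (s : Finset (Subgroup Z2))
    (hs : ∀ H ∈ s, H.index ≠ 0) (hn : ∀ H : Subgroup Z2, H.index ≠ 0 → H.index ≤ n → H ∈ s) :
    Nat.card (Quotient (orbitRel (Perm (Fin n)) (CommutingPair (Fin n)))) =
      ((s.finsuppAntidiag n).filter fun l => ∀ H ∈ s, H.index ∣ l H).card := by
  have hstab : ∀ (p : CommutingPair (Fin n)) (x : Fin n),
      @stabilizer Z2 _ _ p.action x ∈ s := fun p x => by
    let _ := p.action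
    refine hn _ (index_stabilizer_ne_zero x) ?_
    rw [index_stabilizer]
    exact (Set.ncard_le_card _).trans_eq (by simp)
  have hsupp : ∀ (p : CommutingPair (Fin n)) (H : Subgroup Z2), p.count H ≠ 0 → H ∈ s :=
    fun p H h => by
      let _ := p.action
      obtain ⟨⟨x, rfl⟩⟩ := (Nat.card_ne_zero.1 h).1
      exact hstab p x
  let F : CommutingPair (Fin n) → (Subgroup Z2 →₀ ℕ) := fun p => Finsupp.onFinset s p.count (hsupp p)
  have hF : ∀ p, F p ∈ (s.finsuppAntidiag n).filter fun l => ∀ H ∈ s, H.index ∣ l H := fun p => by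
    let _ := p.action
    rw [Finset.mem_filter, Finset.mem_finsuppAntidiag]
    refine ⟨⟨?_, Finsupp.support_onFinset_subset⟩, fun H _ => ?_⟩
    · exact (sum_stabilizerCount s (hstab p)).trans (Nat.card_fin n)
    · exact ⟨_, (stabilizerCount_eq_mul_index (Fin n) H).trans (mul_comm _ _)⟩
  have hFeq : ∀ p q, F p = F q ↔ orbitRel (Perm (Fin n)) (CommutingPair (Fin n)) p q := fun p q => by
    rw [CommutingPair.orbitRel_iff_count_eq, DFunLike.ext_iff]
    rfl
  rw [← Nat.card_eq_finsetCard]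
  refine Nat.card_congr (Equiv.ofBijective
    (Quotient.lift (fun p => ⟨F p, hF p⟩) fun p q h => Subtype.ext ((hFeq p q).2 h)) ⟨?_, ?_⟩)
  · rintro ⟨p⟩ ⟨q⟩ h
    exact Quotient.sound ((hFeq p q).1 (congrArg Subtype.val h))
  · rintro ⟨l, hl⟩
    rw [Finset.mem_filter, Finset.mem_finsuppAntidiag] at hl
    obtain ⟨⟨hsum, hsub⟩, hdvd⟩ := hl
    -- Surjectivity: `l H / H.index` copies of `Z2 ⧸ H` contain exactly `l H` points with stabilizer
    -- `H`.
    let Y := CosetUnion s fun H => l H / H.index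
    have hY : ∀ H ∈ s, stabilizerCount Y H = l H := fun H hH => by
      rw [stabilizerCount_cosetUnion hH, Nat.div_mul_cancel (hdvd H hH)]
    have : ∀ H : s, Finite (Z2 ⧸ H.1) := fun H =>
      Subgroup.index_ne_zero_iff_finite.1 (hs H.1 H.2)
    have hcard : Nat.card Y = n := by
      rw [← sum_stabilizerCount s fun y : Y => (stabilizer_cosetUnion y).symm ▸ y.1.1.2, ← hsum]
      exact Finset.sum_congr rfl hY
    obtain ⟨p, hp⟩ := exists_commutingPair_count_eq (Finite.equivFinOfCardEq hcard)
    refine ⟨Quotient.mk _ p, Subtype.ext (Finsupp.ext fun H => ?_)⟩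
    change p.count H = l H
    by_cases hH : H ∈ s
    · rw [hp, hY H hH]
    · rw [Finsupp.notMem_support_iff.1 fun h => hH (hsub h)]
      by_contra h
      exact hH (hsupp p H h)

end CommutingPairs

/-! ### Burnside count and the infinite product. -/

theorem commutingTriples_eq_card_orbits_mul_factorial (n : ℕ) :
    commutingTriples n = Nat.card (Quotient (MulAction.orbitRel (Equiv.Perm (Fin n))
      (CommutingPair (Fin n)))) * n.factorial := by
  have hfix : ∀ (a : Equiv.Perm (Fin n)) (q : CommutingPair (Fin n)),
      q ∈ MulAction.fixedBy (CommutingPair (Fin n)) a ↔ Commute a q.1.1 ∧ Commute a q.1.2 :=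
    fun a q => CommutingPair.smul_eq_iff
  let E : {p : Equiv.Perm (Fin n) × Equiv.Perm (Fin n) × Equiv.Perm (Fin n) //
      Commute p.1 p.2.1 ∧ Commute p.1 p.2.2 ∧ Commute p.2.1 p.2.2} ≃
      Σ a : Equiv.Perm (Fin n), MulAction.fixedBy (CommutingPair (Fin n)) a :=
    { toFun p := ⟨p.1.1, ⟨p.1.2, p.2.2.2⟩, (hfix _ _).2 ⟨p.2.1, p.2.2.1⟩⟩
      invFun x := ⟨(x.1, x.2.1.1), ((hfix _ _).1 x.2.2).1, ((hfix _ _).1 x.2.2).2, x.2.1.2⟩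
      left_inv _ := rfl
      right_inv _ := rfl }
  rw [commutingTriples, Nat.card_congr (E.trans (MulAction.sigmaFixedByEquivOrbitsProdGroup _ _)),
    Nat.card_prod, Nat.card_perm, Nat.card_fin]

/-- With the shift `j + 1`, `Finset.range n` covers the indices 1 to `n`; further factors leave
coefficient `n` unchanged, which gives formal convergence. -/
theorem coeff_prod_inv_pow_sigma {n : ℕ} {t : Finset ℕ} (ht : Finset.range n ⊆ t) :
    PowerSeries.coeff n (∏ j ∈ t, ((1 - (PowerSeries.X : PowerSeries ℚ) ^ (j + 1))⁻¹) ^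
      ArithmeticFunction.sigma 1 (j + 1)) = (commutingTriples n : ℚ) / (n.factorial : ℚ) := by
  classical
  have hmem : ∀ H, H ∈ t.biUnion (fun j => subgroupsOfIndex (j + 1)) ↔
      ∃ j ∈ t, H.index = j + 1 := fun H => by
    simp [mem_subgroupsOfIndex]
  -- Each power is split into one factor per subgroup of index `j + 1`.
  have hprod : ∏ j ∈ t, ((1 - (PowerSeries.X : PowerSeries ℚ) ^ (j + 1))⁻¹) ^
      ArithmeticFunction.sigma 1 (j + 1) =
      ∏ H ∈ t.biUnion (fun j => subgroupsOfIndex (j + 1)),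
        (1 - (PowerSeries.X : PowerSeries ℚ) ^ H.index)⁻¹ := by
    rw [Finset.prod_biUnion]
    · refine Finset.prod_congr rfl fun j _ => ?_
      rw [← card_subgroupsOfIndex j.succ_ne_zero]
      refine (Finset.prod_eq_pow_card fun H hH => ?_).symm
      rw [(mem_subgroupsOfIndex j.succ_ne_zero).1 hH]
    · intro j _ k _ hjk
      refine Finset.disjoint_left.2 fun H hj hk => hjk ?_
      rw [mem_subgroupsOfIndex (Nat.succ_ne_zero _)] at hj hk
      exact Nat.succ_injective (hj.symm.trans hk)
  have hne : ∀ H ∈ t.biUnion (fun j => subgroupsOfIndex (j + 1)), H.index ≠ 0 := fun H hH => by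
    obtain ⟨j, -, hj⟩ := (hmem H).1 hH
    omega
  rw [hprod, coeff_prod_inv_one_sub_X_pow _ _ fun H hH => Nat.pos_of_ne_zero (hne H hH),
    commutingTriples_eq_card_orbits_mul_factorial, CommutingPair.card_orbits _ hne]
  · rw [Nat.cast_mul, mul_div_cancel_right₀ _ (by exact_mod_cast n.factorial_ne_zero)]
  · intro H h0 hn
    exact (hmem H).2 ⟨H.index - 1, ht (Finset.mem_range.2 (by omega)), by omega⟩

/-- The infinite product over `j ≥ 1` is indexed by `j + 1` with `j : ℕ`. -/
theorem mainTheorem1 :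
    letI : TopologicalSpace (PowerSeries ℚ) := formalTopology
    HasProd
      (fun j : ℕ =>
        ((1 - (PowerSeries.X : PowerSeries ℚ) ^ (j + 1))⁻¹) ^ ArithmeticFunction.sigma 1 (j + 1))
      (PowerSeries.mk fun n : ℕ => (commutingTriples n : ℚ) / (n.factorial : ℚ)) := by
  let _ : TopologicalSpace ℚ := ⊥
  refine (PowerSeries.WithPiTopology.tendsto_iff_coeff_tendsto ℚ _ _ _).2 fun n => ?_
  refine tendsto_nhds_of_eventually_eq ?_
  rw [SummationFilter.unconditional_filter]
  filter_upwards [Filter.eventually_ge_atTop (Finset.range n)] with t ht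
  rw [PowerSeries.coeff_mk, coeff_prod_inv_pow_sigma ht]
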